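/- Let $\mathbb N=\{1,2,\dots\}$ and equip $\{0,1\}^{\mathbb N}$ with the $\sigma$-algebra generated by the finite-dimensional cylinders. For a probability measure $\mu$ on $\{0,1\}^{\mathbb N}$ let $p(j)=\mathbb E_{X\sim\mu}[X(j)]$, and for $n\in\mathbb N$ let $$\Delta_n(\mu)=\mathbb E\,\sup_{j\in\mathbb N}\bigl|\hat p_n(j)-p(j)\bigr|,\qquad \hat p_n=\frac1n\sum_{i=1}^n X_i,$$ where $X_1,\dots,X_n$ are independent draws from $\mu$. For $p\in[0,1]^{\mathbb N}$ write $\Delta_n(p)$ for $\Delta_n(\mu)$ when $\mu$ is the product measure under which the coordinates $X(j)\sim\mathrm{Bernoulli}(p(j))$ are independent. For a non-increasing sequence $a\in[0,\tfrac12]^{\mathbb N}$ with $a(j)\to0$ put $$T(a)=\sup_{j\in\mathbb N}\frac{\log(j+1)}{\log(1/a(j))}\in[0,\infty],$$ where the ratio is $0$ if $a(j)=0$. For an arbitrary probability measure $\mu$ on $\{0,1\}^{\mathbb N}$ with mean $p$ let $\tilde p(j)=\min\{p(j),1-p(j)\}$. If $\tilde p(j)\to0$, put $T(\mu)=T(\tilde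 p^{\downarrow})$, where $\tilde p^{\downarrow}$ is the non-increasing rearrangement of $\tilde p$, that is, $\tilde p^{\downarrow}(j)=\min\{t\ge0:\ |\{i:\tilde p(i)>t\}|<j\}$; otherwise put $T(\mu)=\infty$. **Theorem (Characterization of local Glivenko--Cantelli sequences).** 1. Let $p\in[0,\tfrac12]^{\mathbb N}$ be non-increasing with $p(j)\to0$. Then $\Delta_n(p)\to0$ as $n\to\infty$ if and only if $T(p)<\infty$. 2. Let $\mu$ be any (not necessarily product) probability measure on $\{0,1\}^{\mathbb N}$ with $T(\mu)<\infty$. Then $\Delta_n(\mu)\to0$ as $n\to\infty$. -/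

import Mathlib

open MeasureTheory ProbabilityTheory Filter Topology
open scoped ENNReal unitInterval

/-! Conventions.  Points of the cube `{0,1}^ℕ` are functions `ℕ → Bool` (with `true` read as `1`),
carrying the product `σ`-algebra, which is generated by the finite-dimensional cylinders.
Coordinates are numbered from `0`: index `j : ℕ` is coordinate number `j + 1`, so that `log (j + 1)`
in one-based numbering becomes `log (j + 2)`. -/

namespace LocalGC

/-- The numerical value `0` or `1` of a bit. -/
def bit (b : Bool) : ℝ := if b then 1 else 0

/-- The mean `p = 𝔼_{X ∼ μ} X` of a measure on `{0,1}^ℕ`, coordinate by coordinate. -/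
noncomputable def mean (μ : Measure (ℕ → Bool)) (j : ℕ) : ℝ := ∫ x, bit (x j) ∂μ

/-- The empirical mean `p̂ₙ(j) = n⁻¹ ∑ᵢ Xᵢ(j)` of a sample `X₁, …, Xₙ` of points of `{0,1}^ℕ`. -/
noncomputable def empMean {n : ℕ} (X : Fin n → ℕ → Bool) (j : ℕ) : ℝ :=
  (n : ℝ)⁻¹ * ∑ i, bit (X i j)

/-- The expected maximal deviation `Δₙ(μ) = 𝔼 sup_j |p̂ₙ(j) - p(j)|`, the expectation being over
`n` independent draws from `μ`, that is, over the `n`-fold product of `μ`. -/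
noncomputable def Delta (n : ℕ) (μ : Measure (ℕ → Bool)) : ℝ≥0∞ :=
  ∫⁻ X : Fin n → ℕ → Bool, ⨆ j, ENNReal.ofReal |empMean X j - mean μ j|
    ∂(Measure.pi fun _ => μ)

/-- The product measure on `{0,1}^ℕ` with independent coordinates `X(j) ∼ Bernoulli(p(j))`. -/
noncomputable def productBernoulli (p : ℕ → I) : Measure (ℕ → Bool) :=
  Measure.infinitePi fun j => bernoulliMeasure true false (p j)

/-- `T(a) = sup_j log (j + 1) / log (1 / a(j))` (one-based `j`) as an extended nonnegative real, for
sequences with values in `[0, 1/2]`.  If `a(j) = 0` then `log (1 / a(j)) = ∞`, so the ratio is `0`. -/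
noncomputable def T (a : ℕ → ℝ) : ℝ≥0∞ :=
  ⨆ j : ℕ, if a j = 0 then 0
    else ENNReal.ofReal (Real.log ((j : ℝ) + 2) / Real.log (1 / a j))

/-- The non-increasing rearrangement of a bounded sequence of nonnegative reals: its value at the
(zero-based) index `j` is the least `t ≥ 0` such that at most `j` terms of the sequence exceed `t`.
For a sequence tending to `0` this lists the positive terms in non-increasing order with
multiplicity, followed by zeros if there are only finitely many of them. -/
noncomputable def decreasingRearrangement (a : ℕ → ℝ) (j : ℕ) : ℝ :=
  sInf {t : ℝ | 0 ≤ t ∧ {i | t < a i}.encard ≤ j}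

/-- `p̃(j) = min {p(j), 1 - p(j)}`, where `p` is the mean of `μ`. -/
noncomputable def foldedMean (μ : Measure (ℕ → Bool)) (j : ℕ) : ℝ :=
  min (mean μ j) (1 - mean μ j)

open Classical in
/-- `T(μ)` for an arbitrary measure on `{0,1}^ℕ`: the value of `T` on the non-increasing
rearrangement of `p̃` if `p̃(j) → 0`, and `∞` otherwise. -/
noncomputable def TMeasure (μ : Measure (ℕ → Bool)) : ℝ≥0∞ :=
  if Tendsto (foldedMean μ) atTop (𝓝 0) then T (decreasingRearrangement (foldedMean μ)) else ∞

end LocalGC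

namespace LocalGC

/-! The condition on `T` is a summability condition: a non-increasing `a` with values in `[0, 1/2]`
has `T a < ∞` exactly when `∑ a j ^ k` converges for some `k ≥ 1`.

If the rarer-value probabilities `q j` are `k`-th power summable, let `S j` count the sample points
showing the rarer value of coordinate `j`. Then `S j choose k` has expectation `(n choose k) * q j ^
k`, and a frequency above `k / n + δ` forces `S j choose k ≥ δ ^ k * (n choose k)`. Summing over a
tail of coordinates bounds the expected tail supremum uniformly in large `n`; Chebyshev-type
variance bounds handle the finitely many remaining coordinates. Only linearity of expectation is
used across coordinates, so their joint law is irrelevant (`tendsto_lintegral_iSup_deviation`).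

Conversely, if no power is summable and the coordinates are independent, then for each fixed `n` the
second Borel–Cantelli lemma yields almost surely a coordinate where all `n` draws equal `1`. Its
mean is at most `1/2`, so `Δₙ ≥ 1/2` (`half_le_Delta_of_not_summable_pow`). -/

/-! ### Finiteness of `T` as power summability -/

lemma exists_summable_pow_of_T_lt_top {a : ℕ → ℝ} (h0 : ∀ j, 0 ≤ a j) (h1 : ∀ j, a j ≤ 1 / 2)
    (hT : T a < ∞) : ∃ k : ℕ, k ≠ 0 ∧ Summable fun j => a j ^ k := by
  -- From `log (j + 2) ≤ T * log (1 / a j)` and `k > 2 * T` one gets `a j ^ k ≤ (j + 2)⁻²`.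
  obtain ⟨k, hk⟩ := exists_nat_gt (2 * (T a).toReal)
  have hk0 : k ≠ 0 := by
    rintro rfl
    have : 0 ≤ (T a).toReal := ENNReal.toReal_nonneg
    push_cast at hk
    linarith
  refine ⟨k, hk0, ?_⟩
  have hs : Summable fun j : ℕ => (1 : ℝ) / ((j + 2 : ℕ) : ℝ) ^ 2 :=
    (summable_nat_add_iff 2).2 (Real.summable_one_div_nat_pow.2 one_lt_two)
  refine Summable.of_nonneg_of_le (fun j => pow_nonneg (h0 j) k) (fun j => ?_) hs
  rcases (h0 j).eq_or_lt' with hj | hj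
  · rw [hj, zero_pow hk0]
    positivity
  have hL : 0 < Real.log (1 / a j) := Real.log_pos (by
    rw [lt_div_iff₀ hj]
    linarith [h1 j])
  have hle : ENNReal.ofReal (Real.log ((j : ℝ) + 2) / Real.log (1 / a j)) ≤ T a := by
    have := le_iSup (fun j : ℕ => if a j = 0 then 0
      else ENNReal.ofReal (Real.log ((j : ℝ) + 2) / Real.log (1 / a j))) j
    rw [if_neg hj.ne'] at this
    exact this
  have hlog : Real.log ((j : ℝ) + 2) ≤ (T a).toReal * Real.log (1 / a j) := by
    rw [← div_le_iff₀ hL]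
    exact (ENNReal.ofReal_le_iff_le_toReal hT.ne).1 hle
  have hj2 : (0 : ℝ) < (j : ℝ) + 2 := by positivity
  have key : Real.log (a j ^ k) ≤ Real.log (1 / ((j : ℝ) + 2) ^ 2) := by
    rw [Real.log_pow, one_div, Real.log_inv, Real.log_pow]
    have : Real.log (1 / a j) = -Real.log (a j) := by rw [one_div, Real.log_inv]
    rw [this] at hlog hL
    push_cast
    nlinarith
  push_cast
  exact (Real.log_le_log_iff (by positivity) (by positivity)).1 key

/-- By monotonicity the first `j + 1` terms each dominate `a j ^ k`, so `(j + 1) * a j ^ k` is at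
most the whole sum; take logarithms. -/
lemma T_lt_top_of_summable_pow {a : ℕ → ℝ} (h0 : ∀ j, 0 ≤ a j) (h1 : ∀ j, a j ≤ 1 / 2)
    (ha : Antitone a) {k : ℕ} (hs : Summable fun j => a j ^ k) : T a < ∞ := by
  set S : ℝ := ∑' j, a j ^ k with hS
  have hS0 : 0 ≤ S := tsum_nonneg fun j => pow_nonneg (h0 j) k
  refine lt_of_le_of_lt (iSup_le fun j => ?_)
    (ENNReal.ofReal_lt_top (r := Real.log (2 * (S + 1)) / Real.log 2 + k))
  split_ifs with hj
  · exact zero_le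
  have hj : 0 < a j := lt_of_le_of_ne (h0 j) (Ne.symm hj)
  apply ENNReal.ofReal_le_ofReal
  have hl2 : 0 < Real.log 2 := Real.log_pos one_lt_two
  have hL : Real.log 2 ≤ Real.log (1 / a j) := Real.log_le_log two_pos (by
    rw [le_div_iff₀ hj]
    linarith [h1 j])
  have hsum : ((j : ℝ) + 1) * a j ^ k ≤ S := by
    calc ((j : ℝ) + 1) * a j ^ k = ∑ i ∈ Finset.range (j + 1), a j ^ k := by simp
      _ ≤ ∑ i ∈ Finset.range (j + 1), a i ^ k := Finset.sum_le_sum fun i hi =>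
          pow_le_pow_left₀ (h0 j) (ha (Nat.lt_succ_iff.1 (Finset.mem_range.1 hi))) k
      _ ≤ S := hs.sum_le_tsum _ fun i _ => pow_nonneg (h0 i) k
  have hpos : 0 < a j ^ k := pow_pos hj k
  -- The added `1` makes `log (2 * (S + 1))` nonnegative; it can then be absorbed using `log (1 / a
  -- j) ≥ log 2`.
  have hsum' : ((j : ℝ) + 2) * a j ^ k ≤ 2 * (S + 1) := by
    have : (0 : ℝ) ≤ j * a j ^ k := by positivity
    nlinarith
  have hlog : Real.log ((j : ℝ) + 2) ≤ Real.log (2 * (S + 1)) + k * Real.log (1 / a j) := by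
    have := Real.log_le_log (by positivity) hsum'
    rw [Real.log_mul (by positivity) hpos.ne', Real.log_pow] at this
    rw [one_div, Real.log_inv]
    linarith
  have hS1 : 0 ≤ Real.log (2 * (S + 1)) := Real.log_nonneg (by linarith)
  rw [div_le_iff₀ (by linarith)]
  have : Real.log (2 * (S + 1)) ≤ Real.log (2 * (S + 1)) / Real.log 2 * Real.log (1 / a j) := by
    rw [div_mul_eq_mul_div, le_div_iff₀ hl2]
    exact mul_le_mul_of_nonneg_left hL hS1
  linarith

/-! ### Power sums and the non-increasing rearrangement -/

lemma decreasingRearrangement_nonneg (a : ℕ → ℝ) (j : ℕ) : 0 ≤ decreasingRearrangement a j :=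
  Real.sInf_nonneg fun _ ht => ht.1

lemma decreasingRearrangement_le {a : ℕ → ℝ} {c : ℝ} (hc : 0 ≤ c) (h : ∀ j, a j ≤ c) (j : ℕ) :
    decreasingRearrangement a j ≤ c := by
  refine csInf_le ⟨0, fun _ ht => ht.1⟩ ⟨hc, ?_⟩
  have : {i | c < a i} = ∅ := Set.eq_empty_of_forall_notMem fun i hi => not_lt.2 (h i) hi
  simp [this]

/-- If more than `m` terms of `a` are at least `x`, then so is the `m`-th term of the
rearrangement. -/
lemma le_decreasingRearrangement {a : ℕ → ℝ} {c x : ℝ} (hc : 0 ≤ c) (h : ∀ j, a j ≤ c)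
    {s : Finset ℕ} (hs : ∀ i ∈ s, x ≤ a i) {m : ℕ} (hm : m < s.card) :
    x ≤ decreasingRearrangement a m := by
  refine le_csInf ⟨c, hc, ?_⟩ fun t ht => ?_
  · have : {i | c < a i} = ∅ := Set.eq_empty_of_forall_notMem fun i hi => not_lt.2 (h i) hi
    simp [this]
  · by_contra! htx
    have h1 : (s : Set ℕ) ⊆ {i | t < a i} := fun i hi => htx.trans_le (hs i hi)
    have h2 := (Set.encard_le_encard h1).trans ht.2
    rw [Set.encard_coe_eq_coe_finsetCard, Nat.cast_le] at h2
    omega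

/-- Build `s` by adding smallest elements last: when `a i` is added, all `s.card + 1` values are at
least `a i`, so the rearranged term of index `s.card` dominates it. -/
lemma sum_pow_le_sum_decreasingRearrangement {a : ℕ → ℝ} (h0 : ∀ j, 0 ≤ a j) {c : ℝ}
    (h : ∀ j, a j ≤ c) (k : ℕ) (s : Finset ℕ) :
    ∑ i ∈ s, a i ^ k ≤ ∑ m ∈ Finset.range s.card, decreasingRearrangement a m ^ k := by
  induction s using Finset.induction_on_min_value a with
  | empty => simp
  | insert i s his hmin ih =>
    rw [Finset.sum_insert his, Finset.card_insert_of_notMem his, Finset.sum_range_succ, add_comm]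
    refine add_le_add ih (pow_le_pow_left₀ (h0 i) ?_ k)
    refine le_decreasingRearrangement ((h0 0).trans (h 0)) h (s := insert i s) ?_
      (by rw [Finset.card_insert_of_notMem his]; omega)
    simpa using hmin

lemma summable_pow_of_decreasingRearrangement {a : ℕ → ℝ} (h0 : ∀ j, 0 ≤ a j) {c : ℝ}
    (h : ∀ j, a j ≤ c) {k : ℕ} (hs : Summable fun j => decreasingRearrangement a j ^ k) :
    Summable fun j => a j ^ k :=
  summable_of_sum_le (fun j => pow_nonneg (h0 j) k) fun s =>
    (sum_pow_le_sum_decreasingRearrangement h0 h k s).trans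
      (hs.sum_le_tsum _ fun j _ => pow_nonneg (decreasingRearrangement_nonneg a j) k)

/-! ### Binomial moments and the mean deviation of a single event -/

section Counting

variable {Ω : Type*}

open Classical in
/-- The number of sample points lying in `B`. -/
noncomputable def hits {n : ℕ} (B : Set Ω) (X : Fin n → Ω) : ℕ :=
  (Finset.univ.filter fun i => X i ∈ B).card

lemma hits_le {n : ℕ} (B : Set Ω) (X : Fin n → Ω) : hits B X ≤ n :=
  by
  classical
  exact (Finset.card_filter_le _ _).trans (by simp)

/-- Both sides count the `k`-element sets of sample indices whose points all lie in `B`. -/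
lemma choose_hits {n : ℕ} (B : Set Ω) (X : Fin n → Ω) (k : ℕ) :
    ((hits B X).choose k : ℝ≥0∞) = ∑ A ∈ (Finset.univ : Finset (Fin n)).powersetCard k,
      (Set.indicator {Y : Fin n → Ω | ∀ i ∈ A, Y i ∈ B} 1 X : ℝ≥0∞) := by
  classical
  simp only [Set.indicator_apply, Pi.one_apply, Set.mem_ofPred_eq]
  rw [hits, ← Finset.card_powersetCard, Finset.sum_boole]
  congr 2
  ext A
  simp only [Finset.mem_powersetCard, Finset.mem_filter, true_and, Finset.subset_iff,
    Finset.mem_univ]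
  tauto

lemma hits_eq_sum {n : ℕ} (B : Set Ω) (X : Fin n → Ω) :
    (hits B X : ℝ) = ∑ i, B.indicator 1 (X i) := by
  classical
  simp [hits, Set.indicator_apply]

variable [MeasurableSpace Ω]

lemma measurableSet_forall_mem {n : ℕ} {B : Set Ω} (hB : MeasurableSet B) (A : Finset (Fin n)) :
    MeasurableSet {Y : Fin n → Ω | ∀ i ∈ A, Y i ∈ B} := by
  have : {Y : Fin n → Ω | ∀ i ∈ A, Y i ∈ B} = ⋂ i ∈ A, (fun Y => Y i) ⁻¹' B := by
    ext
    simp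
  rw [this]
  exact A.measurableSet_biInter fun i _ => measurable_pi_apply i hB

lemma measurable_choose_hits {n : ℕ} {B : Set Ω} (hB : MeasurableSet B) (k : ℕ) :
    Measurable fun X : Fin n → Ω => ((hits B X).choose k : ℝ≥0∞) := by
  simp_rw [choose_hits]
  exact Finset.measurable_sum _ fun A _ =>
    measurable_one.indicator (measurableSet_forall_mem hB A)

lemma measurable_hits {n : ℕ} {B : Set Ω} (hB : MeasurableSet B) :
    Measurable fun X : Fin n → Ω => (hits B X : ℝ) := by
  have := (measurable_choose_hits (n := n) hB 1).ennreal_toReal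
  simpa using this

variable (μ : Measure Ω) [IsProbabilityMeasure μ]

lemma pi_forall_mem {n : ℕ} (B : Set Ω) (A : Finset (Fin n)) :
    Measure.pi (fun _ : Fin n => μ) {Y | ∀ i ∈ A, Y i ∈ B} = μ B ^ A.card := by
  classical
  have : {Y : Fin n → Ω | ∀ i ∈ A, Y i ∈ B} =
      Set.univ.pi fun i => if i ∈ A then B else Set.univ := by
    ext Y
    simp only [Set.mem_ofPred_eq, Set.mem_pi, Set.mem_univ, true_implies]
    refine forall_congr' fun i => ?_
    split_ifs with h <;> simp [h]
  rw [this, Measure.pi_pi]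
  simp [apply_ite]

lemma lintegral_choose_hits {n : ℕ} {B : Set Ω} (hB : MeasurableSet B) (k : ℕ) :
    ∫⁻ X : Fin n → Ω, ((hits B X).choose k : ℝ≥0∞) ∂(Measure.pi fun _ => μ) =
      n.choose k * μ B ^ k := by
  simp_rw [choose_hits]
  rw [lintegral_finsetSum _ fun A _ =>
    measurable_one.indicator (measurableSet_forall_mem hB A)]
  rw [Finset.sum_congr rfl (g := fun _ => μ B ^ k)]
  · simp
  · intro A hA
    rw [lintegral_indicator_one (measurableSet_forall_mem hB A), pi_forall_mem,
      (Finset.mem_powersetCard.1 hA).2]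

/-- Weak law of large numbers for the relative frequency of an event. -/
lemma lintegral_abs_frequency_sub_le {n : ℕ} (hn : n ≠ 0) {B : Set Ω} (hB : MeasurableSet B) :
    ∫⁻ X : Fin n → Ω, ENNReal.ofReal |(n : ℝ)⁻¹ * hits B X - μ.real B| ∂(Measure.pi fun _ => μ) ≤
      ENNReal.ofReal (2 / √n) := by
  have hn0 : (0 : ℝ) < n := by positivity
  have hmem : ∀ i : Fin n, MemLp (B.indicator (1 : Ω → ℝ)) 2 μ := fun _ =>
    memLp_indicator_const 2 hB 1 (Or.inr (measure_ne_top _ _))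
  have hmean : ∫ X : Fin n → Ω, (hits B X : ℝ) ∂(Measure.pi fun _ => μ) = n * μ.real B := by
    rw [integral_eq_lintegral_of_nonneg_ae (ae_of_all _ fun _ => Nat.cast_nonneg _)
      (measurable_hits hB).aestronglyMeasurable]
    have := lintegral_choose_hits μ (n := n) hB 1
    simp only [Nat.choose_one_right, pow_one] at this
    simp [this, measureReal_def]
  have hvar : Var[fun X : Fin n → Ω => (hits B X : ℝ); Measure.pi fun _ => μ] ≤ n := by
    have h := variance_sum_pi hmem
    have h2 : (∑ i : Fin n, fun X : Fin n → Ω => B.indicator (1 : Ω → ℝ) (X i)) =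
        fun X => (hits B X : ℝ) := by
      ext X
      simp [hits_eq_sum]
    rw [h2] at h
    rw [h]
    have h3 : Var[B.indicator (1 : Ω → ℝ); μ] ≤ 1 := by
      refine (variance_le_sq_of_bounded (a := 0) (b := 1) (ae_of_all _ fun x => ?_)
        (measurable_one.indicator hB).aemeasurable).trans (by norm_num)
      by_cases hx : x ∈ B <;> simp [hx]
    simpa using mul_le_mul_of_nonneg_left h3 hn0.le
  rw [variance_eq_integral (measurable_hits hB).aemeasurable, hmean] at hvar
  have hsqint : Integrable (fun X : Fin n → Ω => ((hits B X : ℝ) - n * μ.real B) ^ 2)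
      (Measure.pi fun _ => μ) := by
    refine Integrable.of_bound
      (((measurable_hits hB).sub_const _).pow_const 2).aestronglyMeasurable ((n : ℝ) ^ 2)
      (ae_of_all _ fun X => ?_)
    have h1 : (hits B X : ℝ) ≤ n := by exact_mod_cast hits_le B X
    have h2 : (0 : ℝ) ≤ hits B X := Nat.cast_nonneg _
    have h3 : n * μ.real B ≤ n := mul_le_of_le_one_right hn0.le measureReal_le_one
    have h4 : 0 ≤ n * μ.real B := by positivity
    rw [Real.norm_eq_abs, abs_pow]
    exact pow_le_pow_left₀ (abs_nonneg _) (abs_le.2 ⟨by linarith, by linarith⟩) 2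
  have hr : 0 < √(n : ℝ) := Real.sqrt_pos.2 hn0
  have hrr : √(n : ℝ) * √n = n := Real.mul_self_sqrt hn0.le
  -- A pointwise form of `z * √n ≤ n + z ^ 2`, replacing Cauchy–Schwarz: since the variance of the
  -- count is at most `n`, each summand integrates to at most `1 / √n`.
  have hpt : ∀ X : Fin n → Ω, |(n : ℝ)⁻¹ * hits B X - μ.real B| ≤
      1 / √n + ((hits B X : ℝ) - n * μ.real B) ^ 2 / (√n * n) := by
    intro X
    set z : ℝ := |(hits B X : ℝ) - n * μ.real B| with hz
    have e1 : (n : ℝ)⁻¹ * hits B X - μ.real B = ((hits B X : ℝ) - n * μ.real B) / n := by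
      field_simp
    rw [e1, abs_div, abs_of_pos hn0, ← hz, ← sq_abs ((hits B X : ℝ) - n * μ.real B), ← hz]
    have e2 : 1 / √(n : ℝ) + z ^ 2 / (√n * n) = (n + z ^ 2) / (√n * n) := by field_simp
    rw [e2, div_le_div_iff₀ hn0 (by positivity)]
    have : z * √n ≤ n + z ^ 2 := by nlinarith [sq_nonneg (z - √n), sq_nonneg z]
    nlinarith
  calc _ ≤ ∫⁻ X : Fin n → Ω, ENNReal.ofReal (1 / √n +
        ((hits B X : ℝ) - n * μ.real B) ^ 2 / (√n * n)) ∂(Measure.pi fun _ => μ) :=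
        lintegral_mono fun X => ENNReal.ofReal_le_ofReal (hpt X)
    _ = ENNReal.ofReal (∫ X : Fin n → Ω, (1 / √n +
        ((hits B X : ℝ) - n * μ.real B) ^ 2 / (√n * n)) ∂(Measure.pi fun _ => μ)) :=
        (ofReal_integral_eq_lintegral_ofReal ((integrable_const _).add (hsqint.div_const _))
          (ae_of_all _ fun X => by simp only [Pi.zero_apply, Pi.add_apply]; positivity)).symm
    _ ≤ ENNReal.ofReal (2 / √n) := by
        refine ENNReal.ofReal_le_ofReal ?_
        rw [integral_add (integrable_const _) (hsqint.div_const _),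
          integral_div (√n * n), integral_const, probReal_univ, one_smul]
        have : (∫ X : Fin n → Ω, ((hits B X : ℝ) - n * μ.real B) ^ 2 ∂(Measure.pi fun _ => μ)) /
            (√n * n) ≤ 1 / √n := by
          rw [div_le_div_iff₀ (by positivity) hr]
          nlinarith
        calc _ ≤ 1 / √(n : ℝ) + 1 / √n := add_le_add_right this _
          _ = 2 / √n := by ring

end Counting

/-- A frequency `s / n` exceeding `k / n + ε` makes `(s choose k) / (n choose k)` at least `ε ^ k`.
-/
lemma frequency_le {n s k : ℕ} (hk : k ≤ n) (hn : n ≠ 0) (hs : s ≤ n) {ε : ℝ} (hε : 0 < ε) :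
    (n : ℝ)⁻¹ * s ≤ k / n + ε + (ε ^ k * n.choose k)⁻¹ * s.choose k := by
  have hn0 : (0 : ℝ) < n := by positivity
  have hc : (0 : ℝ) < n.choose k := by exact_mod_cast Nat.choose_pos hk
  by_cases h : (n : ℝ)⁻¹ * s ≤ k / n + ε
  · exact h.trans (le_add_of_nonneg_right (by positivity))
  push Not at h
  have h1 : (k : ℝ) + ε * n < s := by
    have := mul_lt_mul_of_pos_left h hn0
    field_simp at this
    linarith
  have hks : k ≤ s := by
    have : (k : ℝ) < s := lt_of_le_of_lt (le_add_of_nonneg_right (by positivity)) h1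
    exact_mod_cast this.le
  -- Compare descending factorials: that of `s` is at least `(s + 1 - k) ^ k ≥ (ε * n) ^ k`, that of
  -- `n` at most `n ^ k`.
  have h2 : ε ^ k * n.choose k ≤ s.choose k := by
    have hf : (0 : ℝ) < (k.factorial : ℝ) := by positivity
    refine le_of_mul_le_mul_left ?_ hf
    have e1 : (k.factorial : ℝ) * s.choose k = s.descFactorial k := by
      exact_mod_cast (Nat.descFactorial_eq_factorial_mul_choose s k).symm
    have e2 : (k.factorial : ℝ) * n.choose k = n.descFactorial k := by
      exact_mod_cast (Nat.descFactorial_eq_factorial_mul_choose n k).symm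
    have e3 : (n.descFactorial k : ℝ) ≤ (n : ℝ) ^ k := by
      exact_mod_cast Nat.descFactorial_le_pow n k
    have e4 : ((s + 1 - k : ℕ) : ℝ) ^ k ≤ s.descFactorial k := by
      exact_mod_cast Nat.pow_sub_le_descFactorial s k
    have e5 : ε * n ≤ ((s + 1 - k : ℕ) : ℝ) := by
      rw [Nat.cast_sub (by omega)]
      push_cast
      linarith
    calc (k.factorial : ℝ) * (ε ^ k * n.choose k) = ε ^ k * n.descFactorial k := by
          rw [← e2]; ring
      _ ≤ ε ^ k * (n : ℝ) ^ k := by gcongr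
      _ = (ε * n) ^ k := (mul_pow _ _ _).symm
      _ ≤ ((s + 1 - k : ℕ) : ℝ) ^ k := by gcongr
      _ ≤ _ := by rw [e1]; exact e4
  have h3 : (n : ℝ)⁻¹ * s ≤ 1 := by
    rw [inv_mul_le_iff₀ hn0, mul_one]
    exact_mod_cast hs
  have h4 : 1 ≤ (ε ^ k * n.choose k)⁻¹ * s.choose k := by
    rw [inv_mul_eq_div, le_div_iff₀ (by positivity), one_mul]
    exact h2
  have : (0 : ℝ) ≤ k / n + ε := by positivity
  linarith

/-! ### Uniform law of large numbers for power-summable events -/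

section UpperBound

variable {Ω : Type*} [MeasurableSpace Ω] (μ : Measure Ω)

lemma iSup_deviation_le {n k J : ℕ} (hk : k ≤ n) (hn : n ≠ 0) {B : ℕ → Set Ω} {δ : ℝ}
    (hδ : 0 < δ) (hkn : (k : ℝ) / n ≤ δ) (hJ : ∀ j, J ≤ j → μ.real (B j) ≤ δ) (X : Fin n → Ω) :
    ⨆ j, ENNReal.ofReal |(n : ℝ)⁻¹ * hits (B j) X - μ.real (B j)| ≤
      ∑ j ∈ Finset.range J, ENNReal.ofReal |(n : ℝ)⁻¹ * hits (B j) X - μ.real (B j)| +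
      (ENNReal.ofReal (3 * δ) + ∑' j, ENNReal.ofReal (δ ^ k * n.choose k)⁻¹ *
        ((hits (B (j + J)) X).choose k : ℝ≥0∞)) := by
  refine iSup_le fun j => ?_
  rcases lt_or_ge j J with hj | hj
  · refine le_add_right ?_
    exact Finset.single_le_sum (f := fun j => ENNReal.ofReal
      |(n : ℝ)⁻¹ * hits (B j) X - μ.real (B j)|) (fun _ _ => zero_le) (Finset.mem_range.2 hj)
  · refine le_add_left ?_
    obtain ⟨i, rfl⟩ := Nat.exists_eq_add_of_le' hj
    refine le_trans ?_ (add_le_add_right (ENNReal.le_tsum i) _)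
    rw [← ENNReal.ofReal_natCast (Nat.choose _ _), ← ENNReal.ofReal_mul (by positivity),
      ← ENNReal.ofReal_add (by positivity) (by positivity)]
    refine ENNReal.ofReal_le_ofReal ?_
    have h1 := frequency_le hk hn (hits_le (B (i + J)) X) hδ
    have h2 := hJ _ hj
    have h3 : 0 ≤ μ.real (B (i + J)) := measureReal_nonneg
    have h4 : 0 ≤ (n : ℝ)⁻¹ * hits (B (i + J)) X := by positivity
    -- The frequency exceeds its mean by at most `k / n + δ ≤ 2 * δ` plus the binomial term, and
    -- falls short by at most `δ`; `3 * δ` covers both.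
    refine abs_le.2 ⟨?_, ?_⟩ <;> linarith

variable [IsProbabilityMeasure μ]

lemma lintegral_iSup_deviation_le {n k J : ℕ} (hk : k ≤ n) (hn : n ≠ 0) {B : ℕ → Set Ω}
    (hB : ∀ j, MeasurableSet (B j)) {δ : ℝ}
    (hδ : 0 < δ) (hkn : (k : ℝ) / n ≤ δ) (hJ : ∀ j, J ≤ j → μ.real (B j) ≤ δ)
    (hs : Summable fun j => μ.real (B j) ^ k) :
    ∫⁻ X : Fin n → Ω, ⨆ j, ENNReal.ofReal |(n : ℝ)⁻¹ * hits (B j) X - μ.real (B j)|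
      ∂(Measure.pi fun _ => μ) ≤
    J * ENNReal.ofReal (2 / √n) + (ENNReal.ofReal (3 * δ) +
      ENNReal.ofReal ((δ ^ k)⁻¹ * ∑' j, μ.real (B (j + J)) ^ k)) := by
  have hmeas : ∀ j, Measurable fun X : Fin n → Ω =>
      ENNReal.ofReal |(n : ℝ)⁻¹ * hits (B j) X - μ.real (B j)| := fun j =>
    (continuous_abs.measurable.comp
      (((measurable_hits (hB j)).const_mul _).sub_const _)).ennreal_ofReal
  have hmeas2 : ∀ j, Measurable fun X : Fin n → Ω => ENNReal.ofReal (δ ^ k * n.choose k)⁻¹ *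
      ((hits (B (j + J)) X).choose k : ℝ≥0∞) := fun j =>
    (measurable_choose_hits (hB (j + J)) k).const_mul _
  refine (lintegral_mono fun X => iSup_deviation_le μ hk hn hδ hkn hJ X).trans ?_
  rw [lintegral_add_left (Finset.measurable_sum _ fun j _ => hmeas j),
    lintegral_add_left measurable_const, lintegral_const, measure_univ, mul_one,
    lintegral_finsetSum _ fun j _ => hmeas j, lintegral_tsum fun j => (hmeas2 j).aemeasurable]
  refine add_le_add ?_ (add_le_add_right (le_of_eq ?_) _)
  · refine (Finset.sum_le_sum fun j _ => lintegral_abs_frequency_sub_le μ hn (hB j)).trans ?_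
    simp
  · have hterm : ∀ j, ∫⁻ X : Fin n → Ω, ENNReal.ofReal (δ ^ k * n.choose k)⁻¹ *
        ((hits (B (j + J)) X).choose k : ℝ≥0∞) ∂(Measure.pi fun _ => μ) =
        ENNReal.ofReal ((δ ^ k)⁻¹ * μ.real (B (j + J)) ^ k) := by
      intro j
      have hc : (0 : ℝ) < n.choose k := by exact_mod_cast Nat.choose_pos hk
      rw [lintegral_const_mul _ (measurable_choose_hits (hB (j + J)) k),
        lintegral_choose_hits μ (hB (j + J)), ← ENNReal.ofReal_natCast (Nat.choose _ _),
        ← ofReal_measureReal, ← ENNReal.ofReal_pow measureReal_nonneg,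
        ← ENNReal.ofReal_mul (by positivity), ← ENNReal.ofReal_mul (by positivity)]
      congr 1
      field_simp
    simp_rw [hterm]
    rw [← tsum_mul_left, ENNReal.ofReal_tsum_of_nonneg (fun j => by positivity)
      (((summable_nat_add_iff J).2 hs).mul_left _)]

/-- A uniform law of large numbers for a sequence of events whose probabilities are
`k`-th power summable. -/
theorem tendsto_lintegral_iSup_deviation {B : ℕ → Set Ω} (hB : ∀ j, MeasurableSet (B j)) {k : ℕ}
    (hk : k ≠ 0) (hs : Summable fun j => μ.real (B j) ^ k) :
    Tendsto (fun n : ℕ => ∫⁻ X : Fin n → Ω,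
      ⨆ j, ENNReal.ofReal |(n : ℝ)⁻¹ * hits (B j) X - μ.real (B j)|
        ∂(Measure.pi fun _ => μ)) atTop (𝓝 0) := by
  rw [ENNReal.tendsto_nhds_zero]
  intro ε hε
  obtain ⟨r, hr0, hrε⟩ := ENNReal.lt_iff_exists_nnreal_btwn.1 hε
  have hr : (0 : ℝ) < r := by exact_mod_cast hr0
  -- The five shares: one for the first `J` events, three for `3 * δ`, one for the binomial tail.
  obtain ⟨δ, hδ, hδr⟩ : ∃ δ : ℝ, 0 < δ ∧ 5 * δ = r := ⟨r / 5, by positivity, by ring⟩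
  -- `J` is fixed before `n`. The tail target `δ ^ k * δ` leaves `δ` after division by `δ ^ k`.
  obtain ⟨J, hJ1, hJ2⟩ : ∃ J : ℕ, (∀ j, J ≤ j → μ.real (B j) ≤ δ) ∧
      ∑' j, μ.real (B (j + J)) ^ k ≤ δ ^ k * δ := by
    have h1 := hs.tendsto_atTop_zero.eventually (gt_mem_nhds (pow_pos hδ k))
    obtain ⟨J₁, hJ₁⟩ := eventually_atTop.1 h1
    have h2 := (tendsto_sum_nat_add fun j => μ.real (B j) ^ k).eventually
      (gt_mem_nhds (show 0 < δ ^ k * δ by positivity))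
    obtain ⟨J, hJ, hJJ⟩ := (h2.and (eventually_ge_atTop J₁)).exists
    exact ⟨J, fun j hj => (lt_of_pow_lt_pow_left₀ k hδ.le (hJ₁ j (hJJ.trans hj))).le, hJ.le⟩
  have hlim1 : Tendsto (fun n : ℕ => (k : ℝ) / n) atTop (𝓝 0) :=
    tendsto_const_div_atTop_nhds_zero_nat _
  have hlim2 : Tendsto (fun n : ℕ => J * (2 / √(n : ℝ))) atTop (𝓝 0) := by
    have : Tendsto (fun n : ℕ => √(n : ℝ)) atTop atTop :=
      Real.tendsto_sqrt_atTop.comp tendsto_natCast_atTop_atTop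
    simpa using (this.const_div_atTop 2).const_mul (J : ℝ)
  filter_upwards [hlim1.eventually (gt_mem_nhds hδ), hlim2.eventually (gt_mem_nhds hδ),
    eventually_ge_atTop k] with n h1 h2 h3
  have hn : n ≠ 0 := by omega
  refine (lintegral_iSup_deviation_le μ h3 hn hB hδ h1.le hJ1 hs).trans (le_trans ?_ hrε.le)
  have htail : (δ ^ k)⁻¹ * ∑' j, μ.real (B (j + J)) ^ k ≤ δ := by
    rwa [inv_mul_le_iff₀ (by positivity)]
  have ht0 : 0 ≤ (δ ^ k)⁻¹ * ∑' j, μ.real (B (j + J)) ^ k :=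
    mul_nonneg (by positivity) (tsum_nonneg fun j => by positivity)
  rw [← ENNReal.ofReal_natCast J, ← ENNReal.ofReal_mul (by positivity),
    ← ENNReal.ofReal_add (by positivity) ht0,
    ← ENNReal.ofReal_add (by positivity) (by positivity), ← ENNReal.ofReal_coe_nnreal]
  exact ENNReal.ofReal_le_ofReal (by linarith)

end UpperBound

/-! ### Folding coordinates and the upper bound on the cube -/

section Cube

variable (μ : Measure (ℕ → Bool))

lemma measurableSet_coord_eq (j : ℕ) (b : Bool) : MeasurableSet {x : ℕ → Bool | x j = b} :=
  measurableSet_eq_fun (measurable_pi_apply j) measurable_const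

lemma mean_eq (j : ℕ) : mean μ j = μ.real {x | x j = true} := by
  rw [mean, ← integral_indicator_one (measurableSet_coord_eq j true)]
  congr 1
  ext x
  by_cases hx : x j = true <;> simp [bit, hx]

lemma foldedMean_le_half (j : ℕ) : foldedMean μ j ≤ 1 / 2 := by
  rcases le_total (mean μ j) (1 / 2) with h | h
  · exact (min_le_left _ _).trans h
  · exact (min_le_right _ _).trans (by linarith)

lemma mean_nonneg (j : ℕ) : 0 ≤ mean μ j := by
  rw [mean_eq]
  exact measureReal_nonneg

variable [IsProbabilityMeasure μ]

lemma mean_le_one (j : ℕ) : mean μ j ≤ 1 := by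
  rw [mean_eq]
  exact measureReal_le_one

lemma foldedMean_nonneg (j : ℕ) : 0 ≤ foldedMean μ j :=
  le_min (mean_nonneg μ j) (sub_nonneg.2 (mean_le_one μ j))

lemma hits_coord_true {n : ℕ} (X : Fin n → ℕ → Bool) (j : ℕ) :
    (hits {x : ℕ → Bool | x j = true} X : ℝ) = ∑ i, bit (X i j) := by
  rw [hits_eq_sum]
  refine Finset.sum_congr rfl fun i _ => ?_
  by_cases hx : X i j = true <;> simp [bit, hx]

lemma hits_coord_false {n : ℕ} (X : Fin n → ℕ → Bool) (j : ℕ) :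
    (hits {x : ℕ → Bool | x j = false} X : ℝ) = n - ∑ i, bit (X i j) := by
  have : (n : ℝ) = ∑ _i : Fin n, 1 := by simp
  rw [hits_eq_sum, this, ← Finset.sum_sub_distrib]
  refine Finset.sum_congr rfl fun i _ => ?_
  by_cases hx : X i j = true <;> simp [bit, hx]

/-- Each coordinate deviation is that of the frequency of the rarer value of the coordinate. -/
lemma exists_rare_event (j : ℕ) : ∃ B : Set (ℕ → Bool), MeasurableSet B ∧
    μ.real B = foldedMean μ j ∧ ∀ n : ℕ, n ≠ 0 → ∀ X : Fin n → ℕ → Bool,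
      |empMean X j - mean μ j| = |(n : ℝ)⁻¹ * hits B X - μ.real B| := by
  rcases le_total (mean μ j) (1 / 2) with h | h
  · refine ⟨{x | x j = true}, measurableSet_coord_eq j true, ?_, fun n _ X => ?_⟩
    · rw [foldedMean, min_eq_left (by linarith), mean_eq]
    · rw [empMean, mean_eq, hits_coord_true]
  · have hr : μ.real {x | x j = false} = 1 - mean μ j := by
      rw [mean_eq, ← probReal_compl_eq_one_sub (measurableSet_coord_eq j true)]
      congr 1
      ext x
      simp
    refine ⟨{x | x j = false}, measurableSet_coord_eq j false, ?_, fun n hn X => ?_⟩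
    · rw [foldedMean, min_eq_right (by linarith), hr]
    · rw [empMean, hr, hits_coord_false, ← abs_neg]
      have : (n : ℝ) ≠ 0 := by exact_mod_cast hn
      congr 1
      field_simp
      ring

theorem tendsto_Delta_of_summable_pow {k : ℕ} (hk : k ≠ 0)
    (hs : Summable fun j => foldedMean μ j ^ k) :
    Tendsto (fun n : ℕ => Delta n μ) atTop (𝓝 0) := by
  choose B hB hq hdev using exists_rare_event μ
  have hs' : Summable fun j => μ.real (B j) ^ k := by simpa only [hq] using hs
  refine (tendsto_lintegral_iSup_deviation μ hB hk hs').congr' ?_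
  filter_upwards [eventually_ne_atTop 0] with n hn
  simp only [Delta, hdev _ n hn]

theorem tendsto_Delta_of_TMeasure_lt_top (hT : TMeasure μ < ∞) :
    Tendsto (fun n : ℕ => Delta n μ) atTop (𝓝 0) := by
  have hT' : T (decreasingRearrangement (foldedMean μ)) < ∞ := by
    rw [TMeasure] at hT
    split_ifs at hT
    exacts [hT, absurd hT (lt_irrefl _)]
  have h2 := foldedMean_le_half μ
  obtain ⟨k, hk, hs⟩ := exists_summable_pow_of_T_lt_top (decreasingRearrangement_nonneg _)
    (decreasingRearrangement_le (by norm_num) h2) hT'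
  exact tendsto_Delta_of_summable_pow μ hk
    (summable_pow_of_decreasingRearrangement (foldedMean_nonneg μ) h2 hs)

end Cube

/-! ### Lower bound for product measures -/

section Product

instance isProbabilityMeasure_productBernoulli (p : ℕ → I) :
    IsProbabilityMeasure (productBernoulli p) := by
  unfold productBernoulli
  infer_instance

lemma productBernoulli_forall_true (p : ℕ → I) (s : Finset ℕ) :
    productBernoulli p {x | ∀ j ∈ s, x j = true} = ∏ j ∈ s, ENNReal.ofReal (p j) := by
  have : {x : ℕ → Bool | ∀ j ∈ s, x j = true} = Set.pi s fun _ => {true} := by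
    ext
    simp
  rw [this, productBernoulli, Measure.infinitePi_pi _ fun _ _ => measurableSet_singleton _]
  refine Finset.prod_congr rfl fun j _ => ?_
  rw [← ofReal_measureReal, bernoulliMeasure_real_apply_of_mem_of_notMem _
    (measurableSet_singleton _) (by simp) (by simp)]

lemma mean_productBernoulli (p : ℕ → I) (j : ℕ) : mean (productBernoulli p) j = p j := by
  have := productBernoulli_forall_true p {j}
  simp only [Finset.mem_singleton, forall_eq, Finset.prod_singleton] at this
  rw [mean_eq, measureReal_def, this, ENNReal.toReal_ofReal (p j).2.1]

lemma foldedMean_productBernoulli {p : ℕ → I} (hp : ∀ j, (p j : ℝ) ≤ 1 / 2) (j : ℕ) :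
    foldedMean (productBernoulli p) j = p j := by
  rw [foldedMean, mean_productBernoulli, min_eq_left (by linarith [hp j])]

/-- The events that all `n` draws equal `1` at coordinate `j` are independent in `j` with
probabilities `p j ^ n`, so divergence makes infinitely many of them occur almost surely. -/
lemma half_le_Delta_of_not_summable_pow {p : ℕ → I} (hp : ∀ j, (p j : ℝ) ≤ 1 / 2) {n : ℕ}
    (hn : n ≠ 0) (hs : ¬ Summable fun j => (p j : ℝ) ^ n) :
    ENNReal.ofReal (1 / 2) ≤ Delta n (productBernoulli p) := by
  set ν := productBernoulli p
  let A : ℕ → Set (Fin n → ℕ → Bool) := fun j => {X | ∀ i, X i j = true}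
  -- Independence of the draws gives the exponent `n`; independence of the coordinates gives the
  -- product over `s`.
  have hAs : ∀ s : Finset ℕ, Measure.pi (fun _ : Fin n => ν) (⋂ j ∈ s, A j) =
      ∏ j ∈ s, ENNReal.ofReal ((p j : ℝ) ^ n) := by
    intro s
    have h := pi_forall_mem ν (n := n) {x | ∀ j ∈ s, x j = true} Finset.univ
    rw [productBernoulli_forall_true, Finset.card_univ, Fintype.card_fin,
      ← Finset.prod_pow] at h
    calc _ = Measure.pi (fun _ : Fin n => ν)
          {Y | ∀ i ∈ Finset.univ, Y i ∈ {x : ℕ → Bool | ∀ j ∈ s, x j = true}} := by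
          congr 1
          ext X
          simp only [A, Set.mem_iInter, Set.mem_ofPred_eq, Finset.mem_univ, true_implies]
          tauto
      _ = _ := h
      _ = _ := Finset.prod_congr rfl fun j _ => (ENNReal.ofReal_pow (p j).2.1 n).symm
  have hA1 : ∀ j, Measure.pi (fun _ : Fin n => ν) (A j) = ENNReal.ofReal ((p j : ℝ) ^ n) :=
    fun j => by simpa using hAs {j}
  have hAm : ∀ j, MeasurableSet (A j) := fun j => by
    simpa [A] using measurableSet_forall_mem (n := n) (measurableSet_coord_eq j true) Finset.univ
  have hind : iIndepSet A (Measure.pi fun _ : Fin n => ν) :=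
    (iIndepSet_iff_meas_biInter hAm).2 fun s => by simp only [hAs, hA1]
  have htop : ∑' j, Measure.pi (fun _ : Fin n => ν) (A j) = ∞ := by
    by_contra h
    apply hs
    have := ENNReal.summable_toReal h
    refine this.congr fun j => ?_
    rw [hA1, ENNReal.toReal_ofReal (pow_nonneg (p j).2.1 n)]
  have hone := measure_limsup_eq_one hAm hind htop
  have hae : ∀ᵐ X ∂(Measure.pi fun _ : Fin n => ν), X ∈ limsup A atTop :=
    (prob_compl_eq_zero_iff (MeasurableSet.measurableSet_limsup hAm)).2 hone
  have hle : ∫⁻ _ : Fin n → ℕ → Bool, ENNReal.ofReal (1 / 2) ∂(Measure.pi fun _ => ν) ≤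
      Delta n ν := by
    refine lintegral_mono_ae ?_
    filter_upwards [hae] with X hX
    rw [limsup_eq_iInf_iSup_of_nat] at hX
    simp only [Set.iInf_eq_iInter, Set.iSup_eq_iUnion, Set.mem_iInter, Set.mem_iUnion] at hX
    obtain ⟨j, -, hj⟩ := hX 0
    refine le_trans (ENNReal.ofReal_le_ofReal ?_)
      (le_iSup (fun j => ENNReal.ofReal |empMean X j - mean ν j|) j)
    have hj' : ∀ i, X i j = true := hj
    have hn' : (n : ℝ) ≠ 0 := by exact_mod_cast hn
    have he : empMean X j = 1 := by simp [empMean, bit, hj', hn']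
    rw [he, mean_productBernoulli]
    exact le_trans (by linarith [hp j]) (le_abs_self _)
  simpa using hle

theorem tendsto_Delta_productBernoulli_iff {p : ℕ → I} (hp : ∀ j, (p j : ℝ) ≤ 1 / 2)
    (hanti : Antitone p) :
    Tendsto (fun n : ℕ => Delta n (productBernoulli p)) atTop (𝓝 0) ↔
      T (fun j => (p j : ℝ)) < ∞ := by
  constructor
  · intro h
    by_contra hT
    have hns : ∀ n : ℕ, ¬ Summable fun j => (p j : ℝ) ^ n := fun n hs =>
      hT (T_lt_top_of_summable_pow (fun j => (p j).2.1) hp (fun _ _ hij => hanti hij) hs)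
    have hhalf : (0 : ℝ≥0∞) < ENNReal.ofReal (1 / 2) := ENNReal.ofReal_pos.2 (by norm_num)
    obtain ⟨n, hn, hn0⟩ :=
      ((h.eventually (gt_mem_nhds hhalf)).and (eventually_ne_atTop 0)).exists
    exact absurd hn (not_lt.2 (half_le_Delta_of_not_summable_pow hp hn0 (hns n)))
  · intro hT
    obtain ⟨k, hk, hs⟩ := exists_summable_pow_of_T_lt_top (fun j => (p j).2.1) hp hT
    exact tendsto_Delta_of_summable_pow _ hk
      (by simpa only [foldedMean_productBernoulli hp] using hs)

end Product

end LocalGC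

theorem mainTheorem1 :
    (∀ p : ℕ → I, (∀ j, (p j : ℝ) ≤ 1 / 2) → Antitone p →
      Tendsto (fun j => (p j : ℝ)) atTop (𝓝 0) →
      (Tendsto (fun n : ℕ => LocalGC.Delta n (LocalGC.productBernoulli p)) atTop (𝓝 0) ↔
        LocalGC.T (fun j => (p j : ℝ)) < ∞)) ∧
    (∀ μ : Measure (ℕ → Bool), IsProbabilityMeasure μ → LocalGC.TMeasure μ < ∞ →
      Tendsto (fun n : ℕ => LocalGC.Delta n μ) atTop (𝓝 0)) :=
  ⟨fun _ hp hanti _ => LocalGC.tendsto_Delta_productBernoulli_iff hp hanti,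
    fun μ _ hT => LocalGC.tendsto_Delta_of_TMeasure_lt_top μ hT⟩
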